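/- **Definitions.** All manifolds are smooth, Hausdorff, second countable and without boundary. Let $p,q$ be positive integers. A *metallic Riemannian manifold* $(\overline M,\overline g,J)$ is a Riemannian manifold $(\overline M,\overline g)$ with a smooth $(1,1)$-tensor field $J$ such that $J^2=pJ+qI$ and $\overline g(JX,Y)=\overline g(X,JY)$ for all $X,Y$; it is *locally metallic* if $\overline\nabla J=0$, where $\overline\nabla$ is the Levi-Civita connection of $\overline g$. An immersed submanifold $N$ of $\overline M$ is *invariant* if $J(T_xN)\subseteq T_xN$ for every $x\in N$; it is *pointwise slant* with Wirtinger function $\theta:N\to\mathbb R$ if for every $x\in N$ and every non-zero $X\in T_xN$ the angle in $[0,\pi/2]$ between $JX$ and $T_xN$ equals $\theta_x$, i.e. $\theta_x=\arccos(\|(JX)^{T}\|/\|JX\|)$, where $(JX)^T$ is the orthogonal projection of $JX$ on $T_xN$. Let $(M_T,g_1)$ and $(M_\theta,g_2)$ be non-empty Riemannian manifolds of positive dimension and let $f:M_T\to(0,\infty)$ be smooth. The warped product $M_T\times_fM_\theta$ is the manifold $M_T\times M_\theta$ with the metric $\pi_1^*g_1+(f\circ\pi_1)^2\pi_2^*g_2$.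 Let $\theta:M_\theta\to\mathbb R$. An isometric immersion of $M=M_T\times_fM_\theta$ into $(\overline M,\overline g,J)$ makes $M$ a *warped product pointwise semi-slant submanifold* with invariant base $M_T$ and pointwise slant fibre $M_\theta$ of slant angle $\theta_y$, $y\in M_\theta$, if every leaf $M_T\times\{y\}$ is an invariant submanifold and every leaf $\{x\}\times M_\theta$ ($\cong M_\theta$) is a pointwise slant submanifold with Wirtinger function $y\mapsto\theta_y$. **Theorem.** Let $M=M_T\times_fM_\theta$ be a warped product pointwise semi-slant submanifold of a locally metallic Riemannian manifold $(\overline M,\overline g,J)$, with invariant base $M_T$ and pointwise slant fibre $M_\theta$, whose slant angle satisfies $\theta_y\in(0,\pi/2)$ for all $y\in M_\theta$. Then the warping function $f$ is constant on each connected component of $M_T$. In particular, if $M_T$ is connected, then $f$ is constant, i.e. the warped product is trivial. -/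

import Mathlib

open Bundle Manifold
open scoped ContDiff

noncomputable section

/-- Euclidean space of dimension `n`, the model space of `n`-dimensional manifolds. -/
local notation "𝔼" n:max => EuclideanSpace ℝ (Fin n)

/-- The Riemannian metric `g` of the Riemannian manifold `M` at the point `x`. -/
def riemMetric {n : ℕ} {M : Type*} [TopologicalSpace M] [ChartedSpace (𝔼 n) M]
    [IsManifold (𝓡 n) ∞ M] [RiemannianBundle (fun x : M => TangentSpace (𝓡 n) x)]
    (x : M) (v w : TangentSpace (𝓡 n) x) : ℝ :=
  inner ℝ v w

/-- The orthogonal projection of a tangent vector `u` onto a linear subspace `S` of the tangent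
space, with respect to the Riemannian metric. -/
def tangentProj {n : ℕ} {M : Type*} [TopologicalSpace M] [ChartedSpace (𝔼 n) M]
    [IsManifold (𝓡 n) ∞ M] [RiemannianBundle (fun x : M => TangentSpace (𝓡 n) x)]
    {x : M} (S : Submodule ℝ (TangentSpace (𝓡 n) x)) (u : TangentSpace (𝓡 n) x) :
    TangentSpace (𝓡 n) x :=
  haveI : FiniteDimensional ℝ (TangentSpace (𝓡 n) x) :=
    inferInstanceAs (FiniteDimensional ℝ (𝔼 n))
  S.starProjection u

/-- The angle in `[0, π/2]` between a non-zero tangent vector `u` and a subspace `S` of the tangent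
space: its cosine is the ratio of the length of the projection of `u` on `S` to that of `u`. -/
def angleToSubspace {n : ℕ} {M : Type*} [TopologicalSpace M] [ChartedSpace (𝔼 n) M]
    [IsManifold (𝓡 n) ∞ M] [RiemannianBundle (fun x : M => TangentSpace (𝓡 n) x)]
    {x : M} (u : TangentSpace (𝓡 n) x) (S : Submodule ℝ (TangentSpace (𝓡 n) x)) : ℝ :=
  Real.arccos (‖tangentProj S u‖ / ‖u‖)

/-- `(M, g, J)` is a metallic Riemannian manifold with parameters `p`, `q`: `J` is a smooth
`(1,1)`-tensor field with `J² = pJ + qI`, and `g` is `J`-compatible. -/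
structure IsMetallicRiemannian {m : ℕ} {M : Type*} [TopologicalSpace M] [ChartedSpace (𝔼 m) M]
    [IsManifold (𝓡 m) ∞ M] [RiemannianBundle (fun x : M => TangentSpace (𝓡 m) x)]
    [IsContMDiffRiemannianBundle (𝓡 m) ∞ (𝔼 m) (fun x : M => TangentSpace (𝓡 m) x)]
    (p q : ℕ) (J : ∀ x : M, TangentSpace (𝓡 m) x →L[ℝ] TangentSpace (𝓡 m) x) : Prop where
  smooth : ContMDiff (𝓡 m) ((𝓡 m).prod 𝓘(ℝ, 𝔼 m →L[ℝ] 𝔼 m)) ∞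
    (fun x => TotalSpace.mk' (𝔼 m →L[ℝ] 𝔼 m)
      (E := fun x : M => TangentSpace (𝓡 m) x →L[ℝ] TangentSpace (𝓡 m) x) x (J x))
  sq : ∀ (x : M) (v : TangentSpace (𝓡 m) x), J x (J x v) = (p : ℝ) • J x v + (q : ℝ) • v
  compatible : ∀ (x : M) (v w : TangentSpace (𝓡 m) x),
    riemMetric x (J x v) w = riemMetric x v (J x w)

/-- `∇` is the Levi-Civita connection: torsion-free and compatible with the metric. -/
structure IsLeviCivita {m : ℕ} {M : Type*} [TopologicalSpace M] [ChartedSpace (𝔼 m) M]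
    [IsManifold (𝓡 m) ∞ M] [RiemannianBundle (fun x : M => TangentSpace (𝓡 m) x)]
    [IsContMDiffRiemannianBundle (𝓡 m) ∞ (𝔼 m) (fun x : M => TangentSpace (𝓡 m) x)]
    (cov : CovariantDerivative (𝓡 m) (𝔼 m) (fun x : M => TangentSpace (𝓡 m) x)) : Prop where
  torsion_free : cov.torsion = 0
  metric :
    haveI : IsContMDiffRiemannianBundle (𝓡 m) 1 (𝔼 m) (fun x : M => TangentSpace (𝓡 m) x) :=
      IsContMDiffRiemannianBundle.of_le (n := ∞) (mod_cast le_top)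
    cov.IsMetricCompatible

/-- `∇J = 0`, that is `∇_v (JY) = J (∇_v Y)` for every tangent vector `v` at a point and every
vector field `Y` differentiable at that point. -/
def IsParallel {m : ℕ} {M : Type*} [TopologicalSpace M] [ChartedSpace (𝔼 m) M]
    [IsManifold (𝓡 m) ∞ M]
    (cov : CovariantDerivative (𝓡 m) (𝔼 m) (fun x : M => TangentSpace (𝓡 m) x))
    (J : ∀ x : M, TangentSpace (𝓡 m) x →L[ℝ] TangentSpace (𝓡 m) x) : Prop :=
  ∀ (Y : ∀ x : M, TangentSpace (𝓡 m) x) (x : M),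
    MDifferentiableAt (𝓡 m) (𝓡 m).tangent (fun y => (⟨y, Y y⟩ : TangentBundle (𝓡 m) M)) x →
    ∀ v : TangentSpace (𝓡 m) x, cov (fun y => J y (Y y)) x v = J x (cov Y x v)

/-- `(M, g, J)` is a locally metallic Riemannian manifold: a metallic Riemannian manifold whose
tensor field `J` is parallel for the Levi-Civita connection. (The Levi-Civita connection exists
and is unique on differentiable vector fields.) -/
structure IsLocallyMetallic {m : ℕ} {M : Type*} [TopologicalSpace M] [ChartedSpace (𝔼 m) M]
    [IsManifold (𝓡 m) ∞ M] [RiemannianBundle (fun x : M => TangentSpace (𝓡 m) x)]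
    [IsContMDiffRiemannianBundle (𝓡 m) ∞ (𝔼 m) (fun x : M => TangentSpace (𝓡 m) x)]
    (p q : ℕ) (J : ∀ x : M, TangentSpace (𝓡 m) x →L[ℝ] TangentSpace (𝓡 m) x) : Prop
    extends IsMetallicRiemannian p q J where
  parallel : ∃ cov : CovariantDerivative (𝓡 m) (𝔼 m) (fun x : M => TangentSpace (𝓡 m) x),
    IsLeviCivita cov ∧ IsParallel cov J

/-- The immersed submanifold `φ : N → M` is invariant: `J (T_y N) ⊆ T_y N` for every `y`, where
`T_y N` is identified with its image under the differential of `φ`. -/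
def IsInvariantSubmanifold {m n : ℕ} {M : Type*} [TopologicalSpace M] [ChartedSpace (𝔼 m) M]
    [IsManifold (𝓡 m) ∞ M] {N : Type*} [TopologicalSpace N] [ChartedSpace (𝔼 n) N]
    [IsManifold (𝓡 n) ∞ N]
    (J : ∀ x : M, TangentSpace (𝓡 m) x →L[ℝ] TangentSpace (𝓡 m) x) (φ : N → M) : Prop :=
  ∀ (y : N) (v : TangentSpace (𝓡 n) y),
    J (φ y) (mfderiv (𝓡 n) (𝓡 m) φ y v) ∈ (mfderiv (𝓡 n) (𝓡 m) φ y).range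

/-- The immersed submanifold `φ : N → M` is pointwise slant with Wirtinger function `θ : N → ℝ`:
for every `y` and every non-zero `v` in `T_y N`, the angle between `J v` and `T_y N` is `θ y`. -/
def IsPointwiseSlantSubmanifold {m n : ℕ} {M : Type*} [TopologicalSpace M]
    [ChartedSpace (𝔼 m) M] [IsManifold (𝓡 m) ∞ M]
    [RiemannianBundle (fun x : M => TangentSpace (𝓡 m) x)]
    {N : Type*} [TopologicalSpace N] [ChartedSpace (𝔼 n) N] [IsManifold (𝓡 n) ∞ N]
    (J : ∀ x : M, TangentSpace (𝓡 m) x →L[ℝ] TangentSpace (𝓡 m) x) (φ : N → M)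
    (θ : N → ℝ) : Prop :=
  ∀ (y : N) (v : TangentSpace (𝓡 n) y), v ≠ 0 →
    angleToSubspace (J (φ y) (mfderiv (𝓡 n) (𝓡 m) φ y v))
      (mfderiv (𝓡 n) (𝓡 m) φ y).range = θ y

/-- The warped product metric `π₁^* g₁ + (f ∘ π₁)² π₂^* g₂` on `M₁ × M₂`. -/
def warpedMetric {n₁ n₂ : ℕ} {M₁ M₂ : Type*}
    [TopologicalSpace M₁] [ChartedSpace (𝔼 n₁) M₁] [IsManifold (𝓡 n₁) ∞ M₁]
    [RiemannianBundle (fun x : M₁ => TangentSpace (𝓡 n₁) x)]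
    [TopologicalSpace M₂] [ChartedSpace (𝔼 n₂) M₂] [IsManifold (𝓡 n₂) ∞ M₂]
    [RiemannianBundle (fun x : M₂ => TangentSpace (𝓡 n₂) x)]
    (f : M₁ → ℝ) (z : M₁ × M₂) (v w : TangentSpace ((𝓡 n₁).prod (𝓡 n₂)) z) : ℝ :=
  riemMetric z.1 (mfderiv ((𝓡 n₁).prod (𝓡 n₂)) (𝓡 n₁) Prod.fst z v)
      (mfderiv ((𝓡 n₁).prod (𝓡 n₂)) (𝓡 n₁) Prod.fst z w) +
    f z.1 ^ 2 *
      riemMetric z.2 (mfderiv ((𝓡 n₁).prod (𝓡 n₂)) (𝓡 n₂) Prod.snd z v)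
        (mfderiv ((𝓡 n₁).prod (𝓡 n₂)) (𝓡 n₂) Prod.snd z w)

/-- `ι : M₁ × M₂ → M` is a smooth isometric immersion of the warped product `M₁ ×_f M₂`. -/
structure IsWarpedProductSubmanifold {m n₁ n₂ : ℕ} {M M₁ M₂ : Type*}
    [TopologicalSpace M] [ChartedSpace (𝔼 m) M] [IsManifold (𝓡 m) ∞ M]
    [RiemannianBundle (fun x : M => TangentSpace (𝓡 m) x)]
    [TopologicalSpace M₁] [ChartedSpace (𝔼 n₁) M₁] [IsManifold (𝓡 n₁) ∞ M₁]
    [RiemannianBundle (fun x : M₁ => TangentSpace (𝓡 n₁) x)]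
    [TopologicalSpace M₂] [ChartedSpace (𝔼 n₂) M₂] [IsManifold (𝓡 n₂) ∞ M₂]
    [RiemannianBundle (fun x : M₂ => TangentSpace (𝓡 n₂) x)]
    (f : M₁ → ℝ) (ι : M₁ × M₂ → M) : Prop where
  warping_smooth : ContMDiff (𝓡 n₁) 𝓘(ℝ, ℝ) ∞ f
  warping_pos : ∀ x, 0 < f x
  smooth : ContMDiff ((𝓡 n₁).prod (𝓡 n₂)) (𝓡 m) ∞ ι
  isometric : ∀ (z : M₁ × M₂) (v w : TangentSpace ((𝓡 n₁).prod (𝓡 n₂)) z),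
    riemMetric (ι z) (mfderiv ((𝓡 n₁).prod (𝓡 n₂)) (𝓡 m) ι z v)
      (mfderiv ((𝓡 n₁).prod (𝓡 n₂)) (𝓡 m) ι z w) = warpedMetric f z v w

/-- `ι` makes `M_T ×_f M_θ` a warped product pointwise semi-slant submanifold of `(M, g, J)`:
the base `M_T` is an invariant submanifold and the fibre `M_θ` is a pointwise slant submanifold
with Wirtinger function `θ : M_θ → ℝ`. The two factors are submanifolds of `M` as the leaves
`M_T × {y}` and `{x} × M_θ` of the product. -/
structure IsWarpedProductSemiSlant {m n₁ n₂ : ℕ} {M MT Mθ : Type*}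
    [TopologicalSpace M] [ChartedSpace (𝔼 m) M] [IsManifold (𝓡 m) ∞ M]
    [RiemannianBundle (fun x : M => TangentSpace (𝓡 m) x)]
    [TopologicalSpace MT] [ChartedSpace (𝔼 n₁) MT] [IsManifold (𝓡 n₁) ∞ MT]
    [RiemannianBundle (fun x : MT => TangentSpace (𝓡 n₁) x)]
    [TopologicalSpace Mθ] [ChartedSpace (𝔼 n₂) Mθ] [IsManifold (𝓡 n₂) ∞ Mθ]
    [RiemannianBundle (fun x : Mθ => TangentSpace (𝓡 n₂) x)]
    (J : ∀ x : M, TangentSpace (𝓡 m) x →L[ℝ] TangentSpace (𝓡 m) x)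
    (f : MT → ℝ) (θ : Mθ → ℝ) (ι : MT × Mθ → M) : Prop
    extends IsWarpedProductSubmanifold (m := m) (n₁ := n₁) (n₂ := n₂) f ι where
  invariant : ∀ y : Mθ, IsInvariantSubmanifold (n := n₁) J (fun x : MT => ι (x, y))
  slant : ∀ x : MT, IsPointwiseSlantSubmanifold (n := n₂) J (fun y : Mθ => ι (x, y)) θ

end

/-!
The warping function is locally constant because of two relations for its differential `df`.

Both the metric `g` and the symmetric form `b = g(J ·, ·)` of a locally metallic manifold are
parallel for the Levi-Civita connection, so the Koszul formula holds for either of them, with the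
same second derivative of the immersion (`koszul_formula_along`). Let `X` be tangent to the base
and `Z` to the fibre, both extended as constant fields in charts of the two factors. The base is
invariant, so `JX` is tangent to the base, and the two factors are orthogonal for `g` and for `b`.
The Koszul formulas for `b(X, ∇_Z Z)` and `g(JX, ∇_Z Z)`, which are the same number, then say that
the derivative of `b(Z, Z)` in direction `X` is the derivative of `g(Z, Z)` in direction `JX`
(`fderiv_structureForm_eq`).

On the fibre, the quotient `t = b(Z, Z) / g(Z, Z)` satisfies `t² ≤ cos² θ (p t + q)` by the
Cauchy-Schwarz inequality, because the tangential part of `JZ` has length `cos θ ‖JZ‖`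
(`rayleigh_sq_le`). Equality holds at a given point if `Z` is there an eigenvector of the tangential
part of `J` (`exists_slant_eigenvector`). Along a leaf of the base, `θ` does not vary, so `t` is an
extremum in the direction of the base and its derivative vanishes
(`fderiv_eq_of_quadratic_extremum`). Since `g(Z, Z)` is `f²` times a constant along such a leaf, the
formula above becomes `df(JX) = t df(X)` for all `X` tangent to the base.

If `df ≠ 0`, applying this twice gives `t² = p t + q`, and together with `t² = cos² θ (p t + q)` and
`0 < θ < π / 2` this forces `t = 0` and then `q = 0`, a contradiction (`fderiv_warping_eq_zero`).
-/

local notation "𝔼" n:max => EuclideanSpace ℝ (Fin n)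

/-! ### Calculus of bilinear forms -/

section Calculus

variable {D E F : Type*} [NormedAddCommGroup D] [NormedSpace ℝ D] [NormedAddCommGroup E]
  [NormedSpace ℝ E] [NormedAddCommGroup F] [NormedSpace ℝ F]

lemma differentiableAt_clm_of_apply [FiniteDimensional ℝ E] {f : D → E →L[ℝ] F} {x : D}
    (h : ∀ y, DifferentiableAt ℝ (fun z => f z y) x) : DifferentiableAt ℝ f x := by
  have hd : Module.finrank ℝ E = Module.finrank ℝ (Fin (Module.finrank ℝ E) → ℝ) :=
    (Module.finrank_fin_fun ℝ).symm
  let e₁ := ContinuousLinearEquiv.ofFinrankEq hd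
  let e₂ := (e₁.arrowCongr (1 : F ≃L[ℝ] F)).trans
    (ContinuousLinearEquiv.piRing (Fin (Module.finrank ℝ E)))
  rw [← Function.id_comp f, ← e₂.symm_comp_self]
  exact e₂.symm.differentiable.differentiableAt.comp x (differentiableAt_pi.2 fun i => h _)

set_option synthInstance.maxHeartbeats 200000 in
/-- The derivative of the pull-back of a field of bilinear forms `β` by a map `φ`. -/
lemma hasFDerivAt_pullback_form {φ : D → E} {β : E → E →L[ℝ] E →L[ℝ] ℝ} {z : D}
    (hφ : ContDiffAt ℝ 2 φ z) (hβ : DifferentiableAt ℝ β (φ z)) (u w : D) :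
    ∃ L : D →L[ℝ] ℝ, HasFDerivAt (fun y => β (φ y) (fderiv ℝ φ y u) (fderiv ℝ φ y w)) L z ∧
      ∀ v, L v = fderiv ℝ β (φ z) (fderiv ℝ φ z v) (fderiv ℝ φ z u) (fderiv ℝ φ z w) +
        β (φ z) (fderiv ℝ (fderiv ℝ φ) z v u) (fderiv ℝ φ z w) +
        β (φ z) (fderiv ℝ φ z u) (fderiv ℝ (fderiv ℝ φ) z v w) := by
  have h1 : HasFDerivAt φ (fderiv ℝ φ z) z :=
    (hφ.differentiableAt (by norm_num)).hasFDerivAt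
  have h2 : HasFDerivAt (fderiv ℝ φ) (fderiv ℝ (fderiv ℝ φ) z) z :=
    ((hφ.fderiv_right (m := 1) (by norm_num)).differentiableAt (by norm_num)).hasFDerivAt
  have h3 : HasFDerivAt (fun y => β (φ y)) ((fderiv ℝ β (φ z)).comp (fderiv ℝ φ z)) z :=
    HasFDerivAt.comp (E := D) (F := E) (G := E →L[ℝ] E →L[ℝ] ℝ) (g := β) z hβ.hasFDerivAt h1
  have hu := h2.clm_apply (hasFDerivAt_const u z)
  have hw := h2.clm_apply (hasFDerivAt_const w z)
  refine ⟨_, (h3.clm_apply hu).clm_apply hw, fun v => ?_⟩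
  simp
  ring

set_option synthInstance.maxHeartbeats 200000 in
/-- The Koszul formula in coordinates. Here `T` is the tangent space at `φ z`, `ε a` is the
coordinate field with components `a` at that point, and `Γ a b` is the covariant derivative of
`ε b` in direction `ε a`; the formula needs the symmetry of `Γ`, but not its bilinearity. -/
lemma koszul_coordinates {φ : D → E} {z : D} (hφ : ContDiffAt ℝ 2 φ z) {T : Type*}
    [AddCommGroup T] [Module ℝ T] (ε : E →ₗ[ℝ] T) (Γ : E → E → T) (hΓ : ∀ a b, Γ a b = Γ b a)
    (v w : D) :
    ∃ S : T, ∀ (B : T →ₗ[ℝ] T →ₗ[ℝ] ℝ) (β : E → E →L[ℝ] E →L[ℝ] ℝ),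
      (∀ s t, B s t = B t s) → (∀ a b, β (φ z) a b = B (ε a) (ε b)) →
      DifferentiableAt ℝ β (φ z) →
      (∀ a b c, fderiv ℝ β (φ z) a b c = B (Γ a b) (ε c) + B (ε b) (Γ a c)) →
      ∀ u, fderiv ℝ (fun y => β (φ y) (fderiv ℝ φ y u) (fderiv ℝ φ y w)) z v +
        fderiv ℝ (fun y => β (φ y) (fderiv ℝ φ y u) (fderiv ℝ φ y v)) z w -
        fderiv ℝ (fun y => β (φ y) (fderiv ℝ φ y v) (fderiv ℝ φ y w)) z u =
        2 * B (ε (fderiv ℝ φ z u)) S := by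
  have hsymm : ∀ a b, fderiv ℝ (fderiv ℝ φ) z a b = fderiv ℝ (fderiv ℝ φ) z b a :=
    fun a b => (hφ.isSymmSndFDerivAt (by simp)) a b
  -- `S` is the covariant derivative of `dφ(w)` along `φ` in direction `v`.
  refine ⟨ε (fderiv ℝ (fderiv ℝ φ) z v w) + Γ (fderiv ℝ φ z v) (fderiv ℝ φ z w), ?_⟩
  intro B β hB hβB hβ hβ' u
  obtain ⟨L₁, h₁, e₁⟩ := hasFDerivAt_pullback_form hφ hβ u w
  obtain ⟨L₂, h₂, e₂⟩ := hasFDerivAt_pullback_form hφ hβ u v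
  obtain ⟨L₃, h₃, e₃⟩ := hasFDerivAt_pullback_form hφ hβ v w
  rw [h₁.fderiv, h₂.fderiv, h₃.fderiv, e₁, e₂, e₃]
  simp only [hβ', hβB, map_add]
  rw [hsymm w v, hsymm w u, hsymm v u, hΓ (fderiv ℝ φ z w) (fderiv ℝ φ z v),
    hΓ (fderiv ℝ φ z w) (fderiv ℝ φ z u), hΓ (fderiv ℝ φ z v) (fderiv ℝ φ z u),
    hB _ (ε (fderiv ℝ φ z v)), hB _ (ε (fderiv ℝ φ z w)),
    hB (ε (fderiv ℝ (fderiv ℝ φ) z u w)) (ε (fderiv ℝ φ z v))]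
  ring

end Calculus

/-! ### Parallel bilinear forms and the Koszul formula along a map -/

section Ambient

variable {m : ℕ} {M : Type*} [TopologicalSpace M] [ChartedSpace (𝔼 m) M]
  {D : Type*} [NormedAddCommGroup D] [NormedSpace ℝ D]

lemma contDiffAt_extChartAt_comp {F : D → M} {z : D} (hF : ContMDiffAt 𝓘(ℝ, D) (𝓡 m) 2 F z) :
    ContDiffAt ℝ 2 (extChartAt (𝓡 m) (F z) ∘ F) z :=
  ((contMDiffAt_extChartAt (n := 2)).comp z hF).contDiffAt

variable [IsManifold (𝓡 m) ∞ M]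

/-- The coordinate vector field with constant components `c` in the preferred chart at `p`
(extended by zero outside of the chart domain). -/
noncomputable def coordField (p : M) (c : 𝔼 m) (x : M) : TangentSpace (𝓡 m) x :=
  (trivializationAt (𝔼 m) (TangentSpace (𝓡 m)) p).symmL ℝ x c

lemma coordField_eq_mfderiv {p x : M} (hx : x ∈ (extChartAt (𝓡 m) p).source) (c : 𝔼 m) :
    coordField p c x =
      mfderiv 𝓘(ℝ, 𝔼 m) (𝓡 m) (extChartAt (𝓡 m) p).symm (extChartAt (𝓡 m) p x) c := by
  have h := TangentBundle.symmL_trivializationAt (𝕜 := ℝ) (I := 𝓡 m) (x₀ := p) (x := x)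
    (by simpa using hx)
  rw [ModelWithCorners.range_eq_univ, mfderivWithin_univ] at h
  exact DFunLike.congr_fun h c

lemma mdifferentiableAt_coordField (p : M) (c : 𝔼 m) :
    MDifferentiableAt (𝓡 m) (𝓡 m).tangent
      (fun x => (⟨x, coordField p c x⟩ : TangentBundle (𝓡 m) M)) p := by
  refine ContMDiffAt.mdifferentiableAt (n := 1) ?_ one_ne_zero
  refine (contMDiffAt_section _).2 ?_
  set t := trivializationAt (𝔼 m) (TangentSpace (𝓡 m)) p
  have : ContMDiffAt (𝓡 m) 𝓘(ℝ, 𝔼 m) 1 (fun _ : M => c) p := contMDiffAt_const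
  refine this.congr_of_eventuallyEq ?_
  filter_upwards [t.open_baseSet.mem_nhds (FiberBundle.mem_baseSet_trivializationAt' p)] with x hx
  rw [coordField, t.symmL_apply hx]
  exact congrArg Prod.snd (t.apply_mk_symm hx c)

/-- Coordinate fields commute, at the centre of their chart. -/
lemma mlieBracket_coordField (p : M) (a b : 𝔼 m) :
    VectorField.mlieBracket (𝓡 m) (coordField p a) (coordField p b) p = 0 := by
  -- In the chart, the coordinate fields are constant.
  have key : ∀ c : 𝔼 m, VectorField.mpullbackWithin 𝓘(ℝ, 𝔼 m) (𝓡 m) (extChartAt (𝓡 m) p).symm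
      (coordField p c) (Set.range (𝓡 m)) =ᶠ[nhds (extChartAt (𝓡 m) p p)] fun _ => c := by
    intro c
    filter_upwards [extChartAt_target_mem_nhds (I := 𝓡 m) p] with e he
    rw [VectorField.mpullbackWithin_apply]
    have hi := isInvertible_mfderivWithin_extChartAt_symm (I := 𝓡 m) he
    refine hi.inverse_apply_eq.2 ?_
    rw [coordField_eq_mfderiv ((extChartAt (𝓡 m) p).map_target he), PartialEquiv.right_inv _ he,
      ModelWithCorners.range_eq_univ, mfderivWithin_univ]
  have key' : ∀ (V W : 𝔼 m → 𝔼 m) (e : 𝔼 m), (V =ᶠ[nhds e] fun _ => a) →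
      (W =ᶠ[nhds e] fun _ => b) → ∀ s, VectorField.lieBracketWithin ℝ V W s e = 0 := by
    intro V W e hV hW s
    rw [VectorField.lieBracketWithin, (hV.filter_mono nhdsWithin_le_nhds).fderivWithin_eq
      hV.self_of_nhds, (hW.filter_mono nhdsWithin_le_nhds).fderivWithin_eq hW.self_of_nhds]
    simp
  rw [← VectorField.mlieBracketWithin_univ, VectorField.mlieBracketWithin_apply]
  refine (congrArg _ (key' _ _ _ (key a) (key b) _)).trans ?_
  exact map_zero _

/-- A field of bilinear forms on the tangent spaces is parallel for `∇` if it is symmetric and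
`v (B(X, Y)) = B(∇_v X, Y) + B(X, ∇_v Y)` for fields `X`, `Y` differentiable at a point. -/
structure IsParallelForm
    (cov : CovariantDerivative (𝓡 m) (𝔼 m) (fun x : M => TangentSpace (𝓡 m) x))
    (B : ∀ x : M, TangentSpace (𝓡 m) x →ₗ[ℝ] TangentSpace (𝓡 m) x →ₗ[ℝ] ℝ) : Prop where
  symm : ∀ (x : M) (v w : TangentSpace (𝓡 m) x), B x v w = B x w v
  deriv : ∀ (X Y : ∀ x : M, TangentSpace (𝓡 m) x) (x : M),
    MDifferentiableAt (𝓡 m) (𝓡 m).tangent (fun y => (⟨y, X y⟩ : TangentBundle (𝓡 m) M)) x →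
    MDifferentiableAt (𝓡 m) (𝓡 m).tangent (fun y => (⟨y, Y y⟩ : TangentBundle (𝓡 m) M)) x →
    MDifferentiableAt (𝓡 m) 𝓘(ℝ, ℝ) (fun y => B y (X y) (Y y)) x ∧
    ∀ v : TangentSpace (𝓡 m) x, mfderiv (𝓡 m) 𝓘(ℝ, ℝ) (fun y => B y (X y) (Y y)) x v =
      B x (cov X x v) (Y x) + B x (X x) (cov Y x v)

/-- The bilinear form `B` at the point `x`, in the frame of coordinate fields of the chart at
`p`. -/
noncomputable def coordForm (B : ∀ x : M, TangentSpace (𝓡 m) x →ₗ[ℝ] TangentSpace (𝓡 m) x →ₗ[ℝ] ℝ)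
    (p x : M) : 𝔼 m →L[ℝ] 𝔼 m →L[ℝ] ℝ :=
  LinearMap.toContinuousBilinearMap ((B x).compl₁₂
    ((trivializationAt (𝔼 m) (TangentSpace (𝓡 m)) p).symmL ℝ x : 𝔼 m →ₗ[ℝ] TangentSpace (𝓡 m) x)
    ((trivializationAt (𝔼 m) (TangentSpace (𝓡 m)) p).symmL ℝ x : 𝔼 m →ₗ[ℝ] TangentSpace (𝓡 m) x))

lemma coordForm_apply (B : ∀ x : M, TangentSpace (𝓡 m) x →ₗ[ℝ] TangentSpace (𝓡 m) x →ₗ[ℝ] ℝ)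
    (p x : M) (a b : 𝔼 m) : coordForm B p x a b = B x (coordField p a x) (coordField p b x) :=
  rfl

/-- The partial derivatives of a function in a chart are its derivatives along the coordinate
fields. -/
lemma differentiableAt_comp_extChartAt_symm {h : M → ℝ} {p : M}
    (hh : MDifferentiableAt (𝓡 m) 𝓘(ℝ, ℝ) h p) :
    DifferentiableAt ℝ (h ∘ (extChartAt (𝓡 m) p).symm) (extChartAt (𝓡 m) p p) ∧
    ∀ a : 𝔼 m, fderiv ℝ (h ∘ (extChartAt (𝓡 m) p).symm) (extChartAt (𝓡 m) p p) a =
      mfderiv (𝓡 m) 𝓘(ℝ, ℝ) h p (coordField p a p) := by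
  have h1 : MDifferentiableAt 𝓘(ℝ, 𝔼 m) (𝓡 m) (extChartAt (𝓡 m) p).symm
      (extChartAt (𝓡 m) p p) := by
    have := mdifferentiableWithinAt_extChartAt_symm (I := 𝓡 m) (mem_extChartAt_target (I := 𝓡 m) p)
    rwa [ModelWithCorners.range_eq_univ, mdifferentiableWithinAt_univ] at this
  have hp : (extChartAt (𝓡 m) p).symm (extChartAt (𝓡 m) p p) = p := extChartAt_to_inv p
  have hh' : MDifferentiableAt (𝓡 m) 𝓘(ℝ, ℝ) h
    ((extChartAt (𝓡 m) p).symm (extChartAt (𝓡 m) p p)) := by rwa [hp]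
  refine ⟨mdifferentiableAt_iff_differentiableAt.1 (hh'.comp _ h1), fun a => ?_⟩
  have h2 : ∀ q, q = p → ∀ c : 𝔼 m, (mfderiv (𝓡 m) 𝓘(ℝ, ℝ) h q : 𝔼 m →L[ℝ] ℝ) c =
      (mfderiv (𝓡 m) 𝓘(ℝ, ℝ) h p : 𝔼 m →L[ℝ] ℝ) c := by
    rintro q rfl c; rfl
  rw [coordField_eq_mfderiv (mem_extChartAt_source p), ← mfderiv_eq_fderiv,
    mfderiv_comp_of_eq hh h1 hp]
  exact h2 _ hp _

/-- A parallel form has differentiable components, and their derivatives are given by the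
Christoffel symbols. -/
lemma differentiableAt_coordForm
    {cov : CovariantDerivative (𝓡 m) (𝔼 m) (fun x : M => TangentSpace (𝓡 m) x)}
    {B : ∀ x : M, TangentSpace (𝓡 m) x →ₗ[ℝ] TangentSpace (𝓡 m) x →ₗ[ℝ] ℝ}
    (hB : IsParallelForm cov B) (p : M) :
    DifferentiableAt ℝ (fun e => coordForm B p ((extChartAt (𝓡 m) p).symm e))
      (extChartAt (𝓡 m) p p) ∧
    ∀ a b c : 𝔼 m, fderiv ℝ (fun e => coordForm B p ((extChartAt (𝓡 m) p).symm e))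
      (extChartAt (𝓡 m) p p) a b c =
      B p (cov (coordField p b) p (coordField p a p)) (coordField p c p) +
      B p (coordField p b p) (cov (coordField p c) p (coordField p a p)) := by
  have key := fun b c : 𝔼 m => hB.deriv _ _ p (mdifferentiableAt_coordField p b)
    (mdifferentiableAt_coordField p c)
  have hd : DifferentiableAt ℝ (fun e => coordForm B p ((extChartAt (𝓡 m) p).symm e))
      (extChartAt (𝓡 m) p p) := by
    refine differentiableAt_clm_of_apply fun b => differentiableAt_clm_of_apply fun c => ?_
    exact (differentiableAt_comp_extChartAt_symm (key b c).1).1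
  refine ⟨hd, fun a b c => ?_⟩
  rw [← (key b c).2, ← (differentiableAt_comp_extChartAt_symm (key b c).1).2 a]
  have h2 := (hd.hasFDerivAt.clm_apply (hasFDerivAt_const b _)).clm_apply (hasFDerivAt_const c _)
  have h3 : ((fun y => B y (coordField p b y) (coordField p c y)) ∘ (extChartAt (𝓡 m) p).symm) =
    fun e => coordForm B p ((extChartAt (𝓡 m) p).symm e) b c := rfl
  rw [h3, h2.fderiv]
  simp

/-- The differential of `F`, in coordinates of the chart at `p`. -/
lemma mfderiv_eq_coordField {F : D → M} {p : M} {y : D}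
    (hF : MDifferentiableAt 𝓘(ℝ, D) (𝓡 m) F y) (hy : F y ∈ (extChartAt (𝓡 m) p).source) (u : D) :
    mfderiv 𝓘(ℝ, D) (𝓡 m) F y u =
      coordField p (fderiv ℝ (extChartAt (𝓡 m) p ∘ F) y u) (F y) := by
  have h1 : MDifferentiableAt (𝓡 m) 𝓘(ℝ, 𝔼 m) (extChartAt (𝓡 m) p) (F y) :=
    mdifferentiableAt_extChartAt (by simpa using hy)
  have h2 := mfderivWithin_extChartAt_symm_comp_mfderiv_extChartAt' hy
  rw [coordField_eq_mfderiv hy, ← mfderiv_eq_fderiv, mfderiv_comp y h1 hF]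
  rw [ModelWithCorners.range_eq_univ, mfderivWithin_univ] at h2
  exact (DFunLike.congr_fun h2 (mfderiv 𝓘(ℝ, D) (𝓡 m) F y u)).symm

/-- The components of the pull-back of a field `B` of bilinear forms by `F : D → M`. -/
noncomputable def pullForm (B : ∀ x : M, TangentSpace (𝓡 m) x →ₗ[ℝ] TangentSpace (𝓡 m) x →ₗ[ℝ] ℝ)
    (F : D → M) (u w : D) (y : D) : ℝ :=
  B (F y) (mfderiv 𝓘(ℝ, D) (𝓡 m) F y u) (mfderiv 𝓘(ℝ, D) (𝓡 m) F y w)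

lemma pullForm_eventuallyEq
    (B : ∀ x : M, TangentSpace (𝓡 m) x →ₗ[ℝ] TangentSpace (𝓡 m) x →ₗ[ℝ] ℝ)
    {F : D → M} {z : D} (hF : ContMDiffAt 𝓘(ℝ, D) (𝓡 m) 2 F z) (u w : D) :
    pullForm B F u w =ᶠ[nhds z] fun y =>
      coordForm B (F z) ((extChartAt (𝓡 m) (F z)).symm ((extChartAt (𝓡 m) (F z) ∘ F) y))
        (fderiv ℝ (extChartAt (𝓡 m) (F z) ∘ F) y u)
        (fderiv ℝ (extChartAt (𝓡 m) (F z) ∘ F) y w) := by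
  filter_upwards [(contMDiffAt_iff_contMDiffAt_nhds (I := 𝓘(ℝ, D)) (I' := 𝓡 m) (by simp)).1 hF,
    hF.continuousAt (extChartAt_source_mem_nhds (I := 𝓡 m) (F z))] with y hy hy'
  have hd : MDifferentiableAt 𝓘(ℝ, D) (𝓡 m) F y := hy.mdifferentiableAt (by norm_num)
  rw [pullForm, mfderiv_eq_coordField hd hy', mfderiv_eq_coordField hd hy', Function.comp_apply,
    PartialEquiv.left_inv _ hy', coordForm_apply]

lemma differentiableAt_pullForm
    {cov : CovariantDerivative (𝓡 m) (𝔼 m) (fun x : M => TangentSpace (𝓡 m) x)}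
    {B : ∀ x : M, TangentSpace (𝓡 m) x →ₗ[ℝ] TangentSpace (𝓡 m) x →ₗ[ℝ] ℝ}
    (hB : IsParallelForm cov B) {F : D → M} {z : D} (hF : ContMDiffAt 𝓘(ℝ, D) (𝓡 m) 2 F z)
    (u w : D) : DifferentiableAt ℝ (pullForm B F u w) z := by
  refine DifferentiableAt.congr_of_eventuallyEq ?_ (pullForm_eventuallyEq B hF u w)
  obtain ⟨L, hL, -⟩ := hasFDerivAt_pullback_form (contDiffAt_extChartAt_comp hF)
    (differentiableAt_coordForm hB (F z)).1 u w
  exact hL.differentiableAt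

/-- The Koszul formula for constant fields along a map `F` from a vector space. The vector `S` is
the covariant derivative along `F` of `dF(w)` in direction `v`; it depends on the torsion-free
connection only, and not on the parallel form `B`. -/
theorem koszul_formula_along
    {cov : CovariantDerivative (𝓡 m) (𝔼 m) (fun x : M => TangentSpace (𝓡 m) x)}
    (hcov : cov.torsion = 0) {F : D → M} {z : D} (hF : ContMDiffAt 𝓘(ℝ, D) (𝓡 m) 2 F z)
    (v w : D) :
    ∃ S : TangentSpace (𝓡 m) (F z),
      ∀ B : (∀ x : M, TangentSpace (𝓡 m) x →ₗ[ℝ] TangentSpace (𝓡 m) x →ₗ[ℝ] ℝ),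
      IsParallelForm cov B → ∀ u : D,
        fderiv ℝ (pullForm B F u w) z v + fderiv ℝ (pullForm B F u v) z w -
          fderiv ℝ (pullForm B F v w) z u = 2 * B (F z) (mfderiv 𝓘(ℝ, D) (𝓡 m) F z u) S := by
  have hΓ : ∀ a b : 𝔼 m, cov (coordField (F z) b) (F z) (coordField (F z) a (F z)) =
      cov (coordField (F z) a) (F z) (coordField (F z) b (F z)) := by
    intro a b
    have := (CovariantDerivative.torsion_eq_zero_iff cov).1 hcov
      (mdifferentiableAt_coordField (F z) a) (mdifferentiableAt_coordField (F z) b)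
    rw [mlieBracket_coordField] at this
    exact sub_eq_zero.1 this
  obtain ⟨S, hS⟩ := koszul_coordinates (contDiffAt_extChartAt_comp hF)
    ((trivializationAt (𝔼 m) (TangentSpace (𝓡 m)) (F z)).symmL ℝ (F z) :
      𝔼 m →ₗ[ℝ] TangentSpace (𝓡 m) (F z))
    (fun a b => cov (coordField (F z) b) (F z) (coordField (F z) a (F z))) hΓ v w
  refine ⟨S, fun B hB u => ?_⟩
  obtain ⟨hd, hd'⟩ := differentiableAt_coordForm hB (F z)
  have hz : (extChartAt (𝓡 m) (F z)).symm ((extChartAt (𝓡 m) (F z) ∘ F) z) = F z :=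
    extChartAt_to_inv (F z)
  have := hS (B (F z)) _ (hB.symm (F z)) (fun a b => ?_) hd hd' u
  · rw [(pullForm_eventuallyEq B hF u w).fderiv_eq, (pullForm_eventuallyEq B hF u v).fderiv_eq,
      (pullForm_eventuallyEq B hF v w).fderiv_eq, this,
      mfderiv_eq_coordField (hF.mdifferentiableAt (by norm_num)) (mem_extChartAt_source (F z))]
    rfl
  · rw [hz]
    rfl

end Ambient

/-! ### The parallel forms of a locally metallic manifold -/

section Metallic

variable {m : ℕ} {M : Type*} [TopologicalSpace M] [ChartedSpace (𝔼 m) M]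
  [RiemannianBundle (fun x : M => TangentSpace (𝓡 m) x)]

/-- The Riemannian metric as a field of bilinear forms. -/
noncomputable def metricForm (x : M) : TangentSpace (𝓡 m) x →ₗ[ℝ] TangentSpace (𝓡 m) x →ₗ[ℝ] ℝ :=
  innerₗ (TangentSpace (𝓡 m) x)

/-- The bilinear form `(v, w) ↦ g(Jv, w)`. -/
noncomputable def structureForm (J : ∀ x : M, TangentSpace (𝓡 m) x →L[ℝ] TangentSpace (𝓡 m) x)
    (x : M) : TangentSpace (𝓡 m) x →ₗ[ℝ] TangentSpace (𝓡 m) x →ₗ[ℝ] ℝ :=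
  (metricForm x).comp (J x : TangentSpace (𝓡 m) x →ₗ[ℝ] TangentSpace (𝓡 m) x)

lemma structureForm_apply (J : ∀ x : M, TangentSpace (𝓡 m) x →L[ℝ] TangentSpace (𝓡 m) x)
    (x : M) (v w : TangentSpace (𝓡 m) x) :
    structureForm J x v w = metricForm x (J x v) w := rfl

lemma metricForm_comm (x : M) (v w : TangentSpace (𝓡 m) x) :
    metricForm x v w = metricForm x w v := by
  rw [metricForm, innerₗ_apply_apply, innerₗ_apply_apply, real_inner_comm]

variable [IsManifold (𝓡 m) ∞ M]

lemma metricForm_apply (x : M) (v w : TangentSpace (𝓡 m) x) :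
    metricForm x v w = riemMetric x v w := rfl

variable [IsContMDiffRiemannianBundle (𝓡 m) ∞ (𝔼 m) (fun x : M => TangentSpace (𝓡 m) x)]
  {cov : CovariantDerivative (𝓡 m) (𝔼 m) (fun x : M => TangentSpace (𝓡 m) x)}

lemma isParallelForm_metricForm (hcov : IsLeviCivita cov) : IsParallelForm cov metricForm where
  symm x v w := metricForm_comm x v w
  deriv X Y x hX hY := by
    have : IsContMDiffRiemannianBundle (𝓡 m) 1 (𝔼 m) (fun x : M => TangentSpace (𝓡 m) x) :=
      IsContMDiffRiemannianBundle.of_le (n := ∞) (mod_cast le_top)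
    refine ⟨hX.inner_bundle hY, fun v => ?_⟩
    have := CovariantDerivative.IsMetricCompatible.mvfderiv_inner_eq hcov.metric
      (FiberBundle.extend (𝔼 m) v) hX hY
    simp only [FiberBundle.extend_apply_self] at this
    exact this

/-- If the symmetric endomorphism `J` is parallel, then so is the form `g(J ·, ·)`. -/
lemma isParallelForm_structureForm (hcov : IsLeviCivita cov) {p q : ℕ}
    {J : ∀ x : M, TangentSpace (𝓡 m) x →L[ℝ] TangentSpace (𝓡 m) x}
    (hJ : IsMetallicRiemannian p q J) (hpar : IsParallel cov J) :
    IsParallelForm cov (structureForm J) where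
  symm x v w := by
    rw [structureForm_apply, structureForm_apply, metricForm_comm x (J x w)]
    exact hJ.compatible x v w
  deriv X Y x hX hY := by
    have hJX : MDifferentiableAt (𝓡 m) (𝓡 m).tangent
        (fun y => (⟨y, J y (X y)⟩ : TangentBundle (𝓡 m) M)) x :=
      ((hJ.smooth x).mdifferentiableAt (by simp)).clm_bundle_apply hX
    obtain ⟨h1, h2⟩ := (isParallelForm_metricForm hcov).deriv _ Y x hJX hY
    refine ⟨h1, fun v => (h2 v).trans ?_⟩
    rw [hpar X x hX v, structureForm_apply, structureForm_apply]

end Metallic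

/-! ### Slant subspaces -/

section SlantAlgebra

open scoped RealInnerProductSpace

variable {T : Type*} [NormedAddCommGroup T] [InnerProductSpace ℝ T]
  {S : Submodule ℝ T} {J : T →ₗ[ℝ] T} {p q c : ℝ}

/-- If `Jv` makes the angle `arccos c` with `S ∋ v`, then the Rayleigh quotient `t` of `J` at `v`
satisfies `t² ≤ c² (p t + q)` (here with denominators cleared). -/
lemma rayleigh_sq_le [S.HasOrthogonalProjection] (hJ : J.IsSymmetric)
    (hJ2 : ∀ v, J (J v) = p • J v + q • v) {v : T} (hv : v ∈ S)
    (hc : ‖S.starProjection (J v)‖ = c * ‖J v‖) :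
    ⟪J v, v⟫ ^ 2 ≤ c ^ 2 * (p * ⟪J v, v⟫ + q * ⟪v, v⟫) * ⟪v, v⟫ := by
  have h1 : ⟪J v, v⟫ = ⟪S.starProjection (J v), v⟫ := by
    rw [Submodule.inner_starProjection_left_eq_right, Submodule.starProjection_eq_self_iff.2 hv]
  have h2 : ⟪J v, v⟫ ^ 2 ≤ ‖S.starProjection (J v)‖ ^ 2 * ‖v‖ ^ 2 := by
    rw [h1, ← mul_pow]
    exact sq_le_sq' (neg_le_of_abs_le (abs_real_inner_le_norm _ _)) (real_inner_le_norm _ _)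
  have h3 : ‖J v‖ ^ 2 = p * ⟪J v, v⟫ + q * ⟪v, v⟫ := by
    rw [← real_inner_self_eq_norm_sq, hJ, hJ2, inner_add_right, inner_smul_right,
      inner_smul_right, real_inner_comm]
  rw [hc, mul_pow, h3, ← real_inner_self_eq_norm_sq] at h2
  exact h2

/-- On a slant subspace, the compression of `J` has an eigenvector, and its eigenvalue `t`
satisfies `t² = c² (p t + q)`. -/
lemma exists_slant_eigenvector [FiniteDimensional ℝ S] (hS : S ≠ ⊥) (hJ : J.IsSymmetric)
    (hJ2 : ∀ v, J (J v) = p • J v + q • v)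
    (hc : ∀ v ∈ S, v ≠ 0 → ‖S.starProjection (J v)‖ = c * ‖J v‖) :
    ∃ v ∈ S, v ≠ 0 ∧ ∃ t : ℝ, ⟪J v, v⟫ = t * ⟪v, v⟫ ∧ t ^ 2 = c ^ 2 * (p * t + q) := by
  have : Nontrivial S := Submodule.nontrivial_iff_ne_bot.2 hS
  let A : S →ₗ[ℝ] S := (S.orthogonalProjectionOnto : T →ₗ[ℝ] S) ∘ₗ J ∘ₗ S.subtype
  have hAcoe : ∀ v : S, (A v : T) = S.starProjection (J v) := fun v => rfl
  have hA : A.IsSymmetric := by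
    intro v w
    rw [Submodule.coe_inner, Submodule.coe_inner, hAcoe, hAcoe,
      Submodule.inner_starProjection_left_eq_right, Submodule.starProjection_eq_self_iff.2 w.2, hJ,
      ← Submodule.inner_starProjection_left_eq_right, Submodule.starProjection_eq_self_iff.2 v.2]
  obtain ⟨v, hv⟩ := hA.hasEigenvalue_iSup_of_finiteDimensional.exists_hasEigenvector
  set t : ℝ := _ with ht
  have hv0 : (v : T) ≠ 0 := fun h => hv.2 (Subtype.ext h)
  have hvt : S.starProjection (J v) = t • (v : T) := by
    rw [← hAcoe, hv.apply_eq_smul]; rfl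
  have h1 : ⟪J v, (v : T)⟫ = t * ⟪(v : T), v⟫ := by
    have : ⟪S.starProjection (J v), (v : T)⟫ = ⟪J v, (v : T)⟫ := by
      rw [Submodule.inner_starProjection_left_eq_right, Submodule.starProjection_eq_self_iff.2 v.2]
    rw [← this, hvt, real_inner_smul_left]
  refine ⟨v, v.2, hv0, t, h1, ?_⟩
  have h2 := congrArg (· ^ 2) (hc v v.2 hv0)
  have h3 : ‖J v‖ ^ 2 = p * ⟪J v, (v : T)⟫ + q * ⟪(v : T), v⟫ := by
    rw [← real_inner_self_eq_norm_sq, hJ, hJ2, inner_add_right, inner_smul_right,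
      inner_smul_right, real_inner_comm]
  simp only [hvt, mul_pow, h3, h1, norm_smul, ← real_inner_self_eq_norm_sq, Real.norm_eq_abs,
    sq_abs] at h2
  have h4 : ⟪(v : T), v⟫ ≠ 0 := by simpa using hv0
  apply mul_right_cancel₀ h4
  linear_combination h2

end SlantAlgebra

/-- If the quotient `r / h` is a root of `t² = k (p t + q)` at a point and satisfies
`t² ≤ k (p t + q)` nearby, then its derivative at the point vanishes: `t² - k (p t + q)` has a
local maximum there, and the roots of this quadratic polynomial are simple. -/
lemma fderiv_eq_of_quadratic_extremum {D : Type*} [NormedAddCommGroup D] [NormedSpace ℝ D]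
    {r h : D → ℝ} {a : D} (hr : DifferentiableAt ℝ r a) (hh : DifferentiableAt ℝ h a)
    {p q k t : ℝ} (hq : 0 < q) (hk : 0 < k)
    (hle : ∀ᶠ x in nhds a, r x ^ 2 ≤ k * (p * r x + q * h x) * h x)
    (hra : r a = t * h a) (ht : t ^ 2 = k * (p * t + q)) (ha : h a ≠ 0) (α : D) :
    fderiv ℝ r a α = t * fderiv ℝ h a α := by
  have hmax : IsLocalMax (fun x => r x ^ 2 - k * (p * r x + q * h x) * h x) a := by
    filter_upwards [hle] with x hx
    rw [hra]
    linear_combination hx - h a ^ 2 * ht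
  have hd := ((hr.hasFDerivAt.pow 2).sub ((((hr.hasFDerivAt.const_mul p).add
    (hh.hasFDerivAt.const_mul q)).const_mul k).mul hh.hasFDerivAt))
  have h0 := DFunLike.congr_fun (hmax.hasFDerivAt_eq_zero hd) α
  simp [hra] at h0
  -- The derivative `2t - kp` of `t² - k (p t + q)` at a root, squared, is the discriminant.
  have hdisc : 0 < (2 * t - k * p) ^ 2 := by
    have : (2 * t - k * p) ^ 2 = 4 * k * q + (k * p) ^ 2 := by linear_combination 4 * ht
    rw [this]; positivity
  have hne : h a * (2 * t - k * p) ≠ 0 := mul_ne_zero ha (by rintro h; simp [h] at hdisc)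
  apply mul_left_cancel₀ hne
  linear_combination h0 - 2 * h a * fderiv ℝ h a α * ht

/-! ### Warped products in charts -/

section WarpedProduct

variable {m n n₁ n₂ : ℕ} {M N MT Mθ : Type*}
    [TopologicalSpace M] [ChartedSpace (𝔼 m) M]
    [TopologicalSpace N] [ChartedSpace (𝔼 n) N]
    [TopologicalSpace MT] [ChartedSpace (𝔼 n₁) MT]
    [TopologicalSpace Mθ] [ChartedSpace (𝔼 n₂) Mθ]

section Chart
variable [IsManifold (𝓡 n) ∞ N]

lemma contMDiffAt_extChartAt_symm {x₀ : N} {a : 𝔼 n} (ha : a ∈ (extChartAt (𝓡 n) x₀).target) :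
    ContMDiffAt 𝓘(ℝ, 𝔼 n) (𝓡 n) ∞ (extChartAt (𝓡 n) x₀).symm a :=
  (contMDiffOn_extChartAt_symm x₀).contMDiffAt ((isOpen_extChartAt_target x₀).mem_nhds ha)

lemma bijective_mfderiv_extChartAt_symm {x₀ : N} {a : 𝔼 n}
    (ha : a ∈ (extChartAt (𝓡 n) x₀).target) :
    Function.Bijective (mfderiv 𝓘(ℝ, 𝔼 n) (𝓡 n) (extChartAt (𝓡 n) x₀).symm a) := by
  have := isInvertible_mfderivWithin_extChartAt_symm (I := 𝓡 n) ha
  rw [ModelWithCorners.range_eq_univ, mfderivWithin_univ] at this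
  exact this.bijective

end Chart

/-- The map `ι` in the chart of the first factor at `x₀` and the chart of the second factor at
`y₀`. -/
noncomputable def chartParam (ι : MT × Mθ → M) (x₀ : MT) (y₀ : Mθ) (z : 𝔼 n₁ × 𝔼 n₂) : M :=
  ι ((extChartAt (𝓡 n₁) x₀).symm z.1, (extChartAt (𝓡 n₂) y₀).symm z.2)

variable {ι : MT × Mθ → M}

lemma mfderiv_leaf_inl (hι : ContMDiff ((𝓡 n₁).prod (𝓡 n₂)) (𝓡 m) ∞ ι) (x : MT) (y : Mθ)
    (ξ : TangentSpace (𝓡 n₁) x) :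
    mfderiv (𝓡 n₁) (𝓡 m) (fun x => ι (x, y)) x ξ =
      mfderiv ((𝓡 n₁).prod (𝓡 n₂)) (𝓡 m) ι (x, y) ((ξ, 0) : 𝔼 n₁ × 𝔼 n₂) := by
  have h1 := mfderiv_comp (I := 𝓡 n₁) (x := x) (f := fun x : MT => (x, y)) (g := ι)
    (hι.mdifferentiable (by simp) _)
    ((contMDiff_id.prodMk contMDiff_const : ContMDiff (𝓡 n₁) ((𝓡 n₁).prod (𝓡 n₂)) ∞
      (fun x : MT => (x, y))).mdifferentiable (by simp) _)
  rw [mfderiv_prod_left] at h1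
  exact DFunLike.congr_fun h1 ξ

lemma mfderiv_leaf_inr (hι : ContMDiff ((𝓡 n₁).prod (𝓡 n₂)) (𝓡 m) ∞ ι) (x : MT) (y : Mθ)
    (η : TangentSpace (𝓡 n₂) y) :
    mfderiv (𝓡 n₂) (𝓡 m) (fun y => ι (x, y)) y η =
      mfderiv ((𝓡 n₁).prod (𝓡 n₂)) (𝓡 m) ι (x, y) ((0, η) : 𝔼 n₁ × 𝔼 n₂) := by
  have h1 := mfderiv_comp (I := 𝓡 n₂) (x := y) (f := fun y : Mθ => (x, y)) (g := ι)
    (hι.mdifferentiable (by simp) _)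
    ((contMDiff_const.prodMk contMDiff_id : ContMDiff (𝓡 n₂) ((𝓡 n₁).prod (𝓡 n₂)) ∞
      (fun y : Mθ => (x, y))).mdifferentiable (by simp) _)
  rw [mfderiv_prod_right] at h1
  exact DFunLike.congr_fun h1 η

variable [IsManifold (𝓡 n₁) ∞ MT] [IsManifold (𝓡 n₂) ∞ Mθ] {x₀ : MT} {y₀ : Mθ} {z : 𝔼 n₁ × 𝔼 n₂}

lemma contMDiffAt_chartParam (hι : ContMDiff ((𝓡 n₁).prod (𝓡 n₂)) (𝓡 m) ∞ ι)
    (hz₁ : z.1 ∈ (extChartAt (𝓡 n₁) x₀).target) (hz₂ : z.2 ∈ (extChartAt (𝓡 n₂) y₀).target) :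
    ContMDiffAt 𝓘(ℝ, 𝔼 n₁ × 𝔼 n₂) (𝓡 m) ∞ (chartParam ι x₀ y₀) z := by
  have h1 := (contMDiffAt_extChartAt_symm hz₁).comp z
    (contDiff_fst.contMDiff.contMDiffAt (I := 𝓘(ℝ, 𝔼 n₁ × 𝔼 n₂)) (n := ∞))
  have h2 := (contMDiffAt_extChartAt_symm hz₂).comp z
    (contDiff_snd.contMDiff.contMDiffAt (I := 𝓘(ℝ, 𝔼 n₁ × 𝔼 n₂)) (n := ∞))
  exact hι.contMDiffAt.comp z (h1.prodMk h2)

lemma mfderiv_chartParam_inl (hι : ContMDiff ((𝓡 n₁).prod (𝓡 n₂)) (𝓡 m) ∞ ι)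
    (hz₁ : z.1 ∈ (extChartAt (𝓡 n₁) x₀).target) (hz₂ : z.2 ∈ (extChartAt (𝓡 n₂) y₀).target)
    (α : 𝔼 n₁) :
    mfderiv 𝓘(ℝ, 𝔼 n₁ × 𝔼 n₂) (𝓡 m) (chartParam ι x₀ y₀) z ((α, 0) : 𝔼 n₁ × 𝔼 n₂) =
      mfderiv (𝓡 n₁) (𝓡 m) (fun x => ι (x, (extChartAt (𝓡 n₂) y₀).symm z.2))
        ((extChartAt (𝓡 n₁) x₀).symm z.1)
        (mfderiv 𝓘(ℝ, 𝔼 n₁) (𝓡 n₁) (extChartAt (𝓡 n₁) x₀).symm z.1 α) := by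
  have hF := (contMDiffAt_chartParam (m := m) hι hz₁ hz₂).mdifferentiableAt (by simp)
  have hi : HasFDerivAt (fun a : 𝔼 n₁ => (a, z.2)) (ContinuousLinearMap.inl ℝ (𝔼 n₁) (𝔼 n₂)) z.1 :=
    hasFDerivAt_prodMk_left z.1 z.2
  have h1 := mfderiv_comp (I := 𝓘(ℝ, 𝔼 n₁)) (x := z.1) (f := fun a : 𝔼 n₁ => (a, z.2))
    (g := chartParam ι x₀ y₀) hF hi.differentiableAt.mdifferentiableAt
  have hl : MDifferentiableAt (𝓡 n₁) (𝓡 m) (fun x => ι (x, (extChartAt (𝓡 n₂) y₀).symm z.2))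
      ((extChartAt (𝓡 n₁) x₀).symm z.1) :=
    (hι.comp (contMDiff_id.prodMk contMDiff_const)).mdifferentiable (by simp) _
  have h2 := mfderiv_comp z.1 hl ((contMDiffAt_extChartAt_symm hz₁).mdifferentiableAt (by simp))
  have h3 := h1.symm.trans h2
  rw [mfderiv_eq_fderiv, hi.fderiv] at h3
  exact DFunLike.congr_fun h3 α

lemma mfderiv_chartParam_inr (hι : ContMDiff ((𝓡 n₁).prod (𝓡 n₂)) (𝓡 m) ∞ ι)
    (hz₁ : z.1 ∈ (extChartAt (𝓡 n₁) x₀).target) (hz₂ : z.2 ∈ (extChartAt (𝓡 n₂) y₀).target)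
    (γ : 𝔼 n₂) :
    mfderiv 𝓘(ℝ, 𝔼 n₁ × 𝔼 n₂) (𝓡 m) (chartParam ι x₀ y₀) z ((0, γ) : 𝔼 n₁ × 𝔼 n₂) =
      mfderiv (𝓡 n₂) (𝓡 m) (fun y => ι ((extChartAt (𝓡 n₁) x₀).symm z.1, y))
        ((extChartAt (𝓡 n₂) y₀).symm z.2)
        (mfderiv 𝓘(ℝ, 𝔼 n₂) (𝓡 n₂) (extChartAt (𝓡 n₂) y₀).symm z.2 γ) := by
  have hF := (contMDiffAt_chartParam (m := m) hι hz₁ hz₂).mdifferentiableAt (by simp)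
  have hi : HasFDerivAt (fun c : 𝔼 n₂ => (z.1, c)) (ContinuousLinearMap.inr ℝ (𝔼 n₁) (𝔼 n₂)) z.2 :=
    hasFDerivAt_prodMk_right z.1 z.2
  have h1 := mfderiv_comp (I := 𝓘(ℝ, 𝔼 n₂)) (x := z.2) (f := fun c : 𝔼 n₂ => (z.1, c))
    (g := chartParam ι x₀ y₀) hF hi.differentiableAt.mdifferentiableAt
  have hl : MDifferentiableAt (𝓡 n₂) (𝓡 m) (fun y => ι ((extChartAt (𝓡 n₁) x₀).symm z.1, y))
      ((extChartAt (𝓡 n₂) y₀).symm z.2) :=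
    (hι.comp (contMDiff_const.prodMk contMDiff_id)).mdifferentiable (by simp) _
  have h2 := mfderiv_comp z.2 hl ((contMDiffAt_extChartAt_symm hz₂).mdifferentiableAt (by simp))
  have h3 := h1.symm.trans h2
  rw [mfderiv_eq_fderiv, hi.fderiv] at h3
  exact DFunLike.congr_fun h3 γ

variable [IsManifold (𝓡 m) ∞ M] [RiemannianBundle (fun x : M => TangentSpace (𝓡 m) x)]
  [RiemannianBundle (fun x : MT => TangentSpace (𝓡 n₁) x)]
  [RiemannianBundle (fun x : Mθ => TangentSpace (𝓡 n₂) x)] {f : MT → ℝ}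

lemma warpedMetric_apply (f : MT → ℝ) (z : MT × Mθ)
    (v w : TangentSpace ((𝓡 n₁).prod (𝓡 n₂)) z) :
    warpedMetric f z v w =
      metricForm (M := MT) z.1 v.1 w.1 + f z.1 ^ 2 * metricForm (M := Mθ) z.2 v.2 w.2 := by
  rw [warpedMetric, mfderiv_fst, mfderiv_snd]
  rfl

namespace IsWarpedProductSubmanifold

variable (hι : IsWarpedProductSubmanifold (m := m) (n₁ := n₁) (n₂ := n₂) f ι)
include hι

lemma inner_inl_inr (x : MT) (y : Mθ) (ξ : TangentSpace (𝓡 n₁) x) (η : TangentSpace (𝓡 n₂) y) :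
    metricForm (ι (x, y)) (mfderiv (𝓡 n₁) (𝓡 m) (fun x => ι (x, y)) x ξ)
      (mfderiv (𝓡 n₂) (𝓡 m) (fun y => ι (x, y)) y η) = 0 := by
  rw [mfderiv_leaf_inl hι.smooth, mfderiv_leaf_inr hι.smooth, metricForm_apply]
  refine (hι.isometric (x, y) _ _).trans ((warpedMetric_apply f _ _ _).trans ?_)
  change metricForm x ξ (0 : TangentSpace (𝓡 n₁) x) +
    f x ^ 2 * metricForm y (0 : TangentSpace (𝓡 n₂) y) η = 0
  rw [map_zero, map_zero, LinearMap.zero_apply]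
  ring

lemma inner_inr_inr (x : MT) (y : Mθ) (η η' : TangentSpace (𝓡 n₂) y) :
    metricForm (ι (x, y)) (mfderiv (𝓡 n₂) (𝓡 m) (fun y => ι (x, y)) y η)
      (mfderiv (𝓡 n₂) (𝓡 m) (fun y => ι (x, y)) y η') = f x ^ 2 * metricForm y η η' := by
  rw [mfderiv_leaf_inr hι.smooth, mfderiv_leaf_inr hι.smooth, metricForm_apply]
  refine (hι.isometric (x, y) _ _).trans ((warpedMetric_apply f _ _ _).trans ?_)
  change metricForm x (0 : TangentSpace (𝓡 n₁) x) (0 : TangentSpace (𝓡 n₁) x) +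
    f x ^ 2 * metricForm y η η' = f x ^ 2 * metricForm y η η'
  rw [map_zero, zero_add]

end IsWarpedProductSubmanifold

end WarpedProduct

/-! ### The slant fibres -/

section SemiSlant

variable {m n₁ n₂ : ℕ} {M MT Mθ : Type*}
  [TopologicalSpace M] [ChartedSpace (𝔼 m) M] [IsManifold (𝓡 m) ∞ M]
  [RiemannianBundle (fun x : M => TangentSpace (𝓡 m) x)]

/-- The definition of the angle without division; it also holds for `u = 0`. -/
lemma norm_tangentProj_of_angle {x : M} {u : TangentSpace (𝓡 m) x}
    {S : Submodule ℝ (TangentSpace (𝓡 m) x)} {t : ℝ} (h : angleToSubspace u S = t) :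
    ‖tangentProj S u‖ = Real.cos t * ‖u‖ := by
  have : FiniteDimensional ℝ (TangentSpace (𝓡 m) x) :=
    inferInstanceAs (FiniteDimensional ℝ (𝔼 m))
  have hle : ‖tangentProj S u‖ ≤ ‖u‖ := S.norm_starProjection_apply_le u
  have h0 : 0 ≤ ‖tangentProj S u‖ / ‖u‖ := by positivity
  rw [← h, angleToSubspace, Real.cos_arccos (by linarith) (div_le_one_of_le₀ hle (norm_nonneg _))]
  refine (div_mul_cancel_of_imp fun h' => ?_).symm
  exact le_antisymm (hle.trans h'.le) (norm_nonneg _)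

variable [IsContMDiffRiemannianBundle (𝓡 m) ∞ (𝔼 m) (fun x : M => TangentSpace (𝓡 m) x)]
  [TopologicalSpace MT] [ChartedSpace (𝔼 n₁) MT] [IsManifold (𝓡 n₁) ∞ MT]
  [RiemannianBundle (fun x : MT => TangentSpace (𝓡 n₁) x)]
  [TopologicalSpace Mθ] [ChartedSpace (𝔼 n₂) Mθ] [IsManifold (𝓡 n₂) ∞ Mθ]
  [RiemannianBundle (fun x : Mθ => TangentSpace (𝓡 n₂) x)]
  {p q : ℕ} {J : ∀ x : M, TangentSpace (𝓡 m) x →L[ℝ] TangentSpace (𝓡 m) x}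
  {f : MT → ℝ} {θ : Mθ → ℝ} {ι : MT × Mθ → M}

namespace IsWarpedProductSemiSlant

variable (hJ : IsMetallicRiemannian p q J)
  (hι : IsWarpedProductSemiSlant (n₁ := n₁) (n₂ := n₂) J f θ ι)
include hJ hι

/-- The Rayleigh quotient of `J` on the fibres is constrained by the slant angle at every point. -/
lemma structureForm_sq_le (x : MT) (y : Mθ) (η : TangentSpace (𝓡 n₂) y) :
    (structureForm J (ι (x, y)) (mfderiv (𝓡 n₂) (𝓡 m) (fun y => ι (x, y)) y η)
      (mfderiv (𝓡 n₂) (𝓡 m) (fun y => ι (x, y)) y η)) ^ 2 ≤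
    Real.cos (θ y) ^ 2 *
      (p * structureForm J (ι (x, y)) (mfderiv (𝓡 n₂) (𝓡 m) (fun y => ι (x, y)) y η)
        (mfderiv (𝓡 n₂) (𝓡 m) (fun y => ι (x, y)) y η) +
      q * metricForm (ι (x, y)) (mfderiv (𝓡 n₂) (𝓡 m) (fun y => ι (x, y)) y η)
        (mfderiv (𝓡 n₂) (𝓡 m) (fun y => ι (x, y)) y η)) *
      metricForm (ι (x, y)) (mfderiv (𝓡 n₂) (𝓡 m) (fun y => ι (x, y)) y η)
        (mfderiv (𝓡 n₂) (𝓡 m) (fun y => ι (x, y)) y η) := by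
  have : FiniteDimensional ℝ (TangentSpace (𝓡 m) (ι (x, y))) :=
    inferInstanceAs (FiniteDimensional ℝ (𝔼 m))
  rcases eq_or_ne η 0 with rfl | hη
  · simp
  · exact rayleigh_sq_le (T := TangentSpace (𝓡 m) (ι (x, y)))
      (S := (mfderiv (𝓡 n₂) (𝓡 m) (fun y => ι (x, y)) y).range)
      (J := (J (ι (x, y)) : TangentSpace (𝓡 m) (ι (x, y)) →ₗ[ℝ] TangentSpace (𝓡 m) (ι (x, y))))
      (hJ.compatible (ι (x, y))) (hJ.sq (ι (x, y))) ⟨η, rfl⟩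
      (norm_tangentProj_of_angle (hι.slant x y η hη))

/-- At every point there is a vector tangent to the fibre which is an eigenvector of the tangential
part of `J`; the constraint of `structureForm_sq_le` is an equality for it. -/
lemma exists_eigenvector (hn₂ : 0 < n₂) (x : MT) (y : Mθ) :
    ∃ (η : TangentSpace (𝓡 n₂) y) (t : ℝ),
      metricForm (ι (x, y)) (mfderiv (𝓡 n₂) (𝓡 m) (fun y => ι (x, y)) y η)
        (mfderiv (𝓡 n₂) (𝓡 m) (fun y => ι (x, y)) y η) ≠ 0 ∧
      structureForm J (ι (x, y)) (mfderiv (𝓡 n₂) (𝓡 m) (fun y => ι (x, y)) y η)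
        (mfderiv (𝓡 n₂) (𝓡 m) (fun y => ι (x, y)) y η) =
      t * metricForm (ι (x, y)) (mfderiv (𝓡 n₂) (𝓡 m) (fun y => ι (x, y)) y η)
        (mfderiv (𝓡 n₂) (𝓡 m) (fun y => ι (x, y)) y η) ∧
      t ^ 2 = Real.cos (θ y) ^ 2 * (p * t + q) := by
  have : FiniteDimensional ℝ (TangentSpace (𝓡 m) (ι (x, y))) :=
    inferInstanceAs (FiniteDimensional ℝ (𝔼 m))
  have : Nonempty (Fin n₂) := ⟨⟨0, hn₂⟩⟩
  have : Nontrivial (TangentSpace (𝓡 n₂) y) := inferInstanceAs (Nontrivial (𝔼 n₂))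
  obtain ⟨η₀, hη₀⟩ := exists_ne (0 : TangentSpace (𝓡 n₂) y)
  have hne : mfderiv (𝓡 n₂) (𝓡 m) (fun y => ι (x, y)) y η₀ ≠ 0 := by
    intro h0
    have h1 := hι.toIsWarpedProductSubmanifold.inner_inr_inr x y η₀ η₀
    rw [h0, map_zero] at h1
    have h2 : metricForm y η₀ η₀ ≠ 0 := inner_self_ne_zero.2 hη₀
    exact mul_ne_zero (pow_ne_zero 2 (hι.warping_pos x).ne') h2 h1.symm
  have hc : ∀ v ∈ (mfderiv (𝓡 n₂) (𝓡 m) (fun y => ι (x, y)) y).range, v ≠ 0 →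
      ‖tangentProj (mfderiv (𝓡 n₂) (𝓡 m) (fun y => ι (x, y)) y).range (J (ι (x, y)) v)‖ =
        Real.cos (θ y) * ‖J (ι (x, y)) v‖ := by
    rintro _ ⟨η, rfl⟩ hv
    exact norm_tangentProj_of_angle (hι.slant x y η (by rintro rfl; exact hv (map_zero _)))
  obtain ⟨_, ⟨η, rfl⟩, hv0, t, h1, h2⟩ :=
    exists_slant_eigenvector (T := TangentSpace (𝓡 m) (ι (x, y)))
      (S := (mfderiv (𝓡 n₂) (𝓡 m) (fun y => ι (x, y)) y).range)
      (J := (J (ι (x, y)) : TangentSpace (𝓡 m) (ι (x, y)) →ₗ[ℝ] TangentSpace (𝓡 m) (ι (x, y))))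
      (fun h => hne ((Submodule.eq_bot_iff _).1 h _ ⟨η₀, rfl⟩))
      (hJ.compatible (ι (x, y))) (hJ.sq (ι (x, y))) hc
  exact ⟨η, t, inner_self_ne_zero.2 hv0, h1, h2⟩

end IsWarpedProductSemiSlant
end SemiSlant

/-! ### The warping function is locally constant -/

section Constancy

variable {m n₁ n₂ : ℕ} {M MT Mθ : Type*}
  [TopologicalSpace M] [ChartedSpace (𝔼 m) M] [IsManifold (𝓡 m) ∞ M]
  [RiemannianBundle (fun x : M => TangentSpace (𝓡 m) x)]
  [TopologicalSpace MT] [ChartedSpace (𝔼 n₁) MT] [IsManifold (𝓡 n₁) ∞ MT]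
  [RiemannianBundle (fun x : MT => TangentSpace (𝓡 n₁) x)]
  [TopologicalSpace Mθ] [ChartedSpace (𝔼 n₂) Mθ] [IsManifold (𝓡 n₂) ∞ Mθ]
  [RiemannianBundle (fun x : Mθ => TangentSpace (𝓡 n₂) x)]
  {p q : ℕ} {J : ∀ x : M, TangentSpace (𝓡 m) x →L[ℝ] TangentSpace (𝓡 m) x}
  {f : MT → ℝ} {θ : Mθ → ℝ} {ι : MT × Mθ → M}

namespace IsWarpedProductSemiSlant

variable (hι : IsWarpedProductSemiSlant (n₁ := n₁) (n₂ := n₂) J f θ ι)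
include hι

/-- The invariance of the leaves of the base, in charts. -/
lemma exists_structure_eq (x₀ : MT) (y₀ : Mθ) {z : 𝔼 n₁ × 𝔼 n₂}
    (hz₁ : z.1 ∈ (extChartAt (𝓡 n₁) x₀).target) (hz₂ : z.2 ∈ (extChartAt (𝓡 n₂) y₀).target)
    (α : 𝔼 n₁) : ∃ α' : 𝔼 n₁,
      J (chartParam ι x₀ y₀ z) (mfderiv 𝓘(ℝ, 𝔼 n₁ × 𝔼 n₂) (𝓡 m) (chartParam ι x₀ y₀) z
        ((α, 0) : 𝔼 n₁ × 𝔼 n₂)) =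
      mfderiv 𝓘(ℝ, 𝔼 n₁ × 𝔼 n₂) (𝓡 m) (chartParam ι x₀ y₀) z ((α', 0) : 𝔼 n₁ × 𝔼 n₂) := by
  rw [mfderiv_chartParam_inl hι.smooth hz₁ hz₂]
  obtain ⟨ξ', hξ'⟩ := hι.invariant ((extChartAt (𝓡 n₂) y₀).symm z.2)
    ((extChartAt (𝓡 n₁) x₀).symm z.1)
    (mfderiv 𝓘(ℝ, 𝔼 n₁) (𝓡 n₁) (extChartAt (𝓡 n₁) x₀).symm z.1 α)
  obtain ⟨α', rfl⟩ := (bijective_mfderiv_extChartAt_symm hz₁).2 ξ'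
  exact ⟨α', hξ'.symm.trans (mfderiv_chartParam_inl hι.smooth hz₁ hz₂ α').symm⟩

lemma pullForm_metricForm_inl_inr (x₀ : MT) (y₀ : Mθ) {z : 𝔼 n₁ × 𝔼 n₂}
    (hz₁ : z.1 ∈ (extChartAt (𝓡 n₁) x₀).target) (hz₂ : z.2 ∈ (extChartAt (𝓡 n₂) y₀).target)
    (α : 𝔼 n₁) (γ : 𝔼 n₂) :
    pullForm (m := m) metricForm (chartParam ι x₀ y₀) (α, 0) (0, γ) z = 0 := by
  rw [pullForm, mfderiv_chartParam_inl hι.smooth hz₁ hz₂,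
    mfderiv_chartParam_inr hι.smooth hz₁ hz₂]
  exact hι.toIsWarpedProductSubmanifold.inner_inl_inr _ _ _ _

/-- The two factors are orthogonal also for `g(J ·, ·)`, because the base is invariant. -/
lemma pullForm_structureForm_inl_inr (x₀ : MT) (y₀ : Mθ) {z : 𝔼 n₁ × 𝔼 n₂}
    (hz₁ : z.1 ∈ (extChartAt (𝓡 n₁) x₀).target) (hz₂ : z.2 ∈ (extChartAt (𝓡 n₂) y₀).target)
    (α : 𝔼 n₁) (γ : 𝔼 n₂) :
    pullForm (structureForm J) (chartParam ι x₀ y₀) (α, 0) (0, γ) z = 0 := by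
  obtain ⟨α', h⟩ := hι.exists_structure_eq x₀ y₀ hz₁ hz₂ α
  rw [pullForm, structureForm_apply, h]
  exact hι.pullForm_metricForm_inl_inr x₀ y₀ hz₁ hz₂ α' γ

lemma pullForm_metricForm_inr_inr (x₀ : MT) (y₀ : Mθ) {a : 𝔼 n₁} {c : 𝔼 n₂}
    (ha : a ∈ (extChartAt (𝓡 n₁) x₀).target) (hc : c ∈ (extChartAt (𝓡 n₂) y₀).target)
    (γ : 𝔼 n₂) :
    pullForm (m := m) metricForm (chartParam ι x₀ y₀) (0, γ) (0, γ) (a, c) =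
      f ((extChartAt (𝓡 n₁) x₀).symm a) ^ 2 * metricForm ((extChartAt (𝓡 n₂) y₀).symm c)
        (mfderiv 𝓘(ℝ, 𝔼 n₂) (𝓡 n₂) (extChartAt (𝓡 n₂) y₀).symm c γ)
        (mfderiv 𝓘(ℝ, 𝔼 n₂) (𝓡 n₂) (extChartAt (𝓡 n₂) y₀).symm c γ) := by
  rw [pullForm, mfderiv_chartParam_inr (z := (a, c)) hι.smooth ha hc]
  exact hι.toIsWarpedProductSubmanifold.inner_inr_inr _ _ _ _

variable [IsContMDiffRiemannianBundle (𝓡 m) ∞ (𝔼 m) (fun x : M => TangentSpace (𝓡 m) x)]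

/-- If `dF(α', 0) = J dF(α, 0)`, the derivative of the form `g(J ·, ·)` on the fibres in direction
`α` is the derivative of the metric on the fibres in direction `α'`: both are `-2 g(dF(α', 0), S)`,
where `S` is the second derivative of `F` in direction of the fibre. -/
lemma fderiv_structureForm_eq
    {cov : CovariantDerivative (𝓡 m) (𝔼 m) (fun x : M => TangentSpace (𝓡 m) x)}
    (hJ : IsMetallicRiemannian p q J) (hcov : IsLeviCivita cov) (hpar : IsParallel cov J)
    (x₀ : MT) (y₀ : Mθ) {z : 𝔼 n₁ × 𝔼 n₂}
    (hz₁ : z.1 ∈ (extChartAt (𝓡 n₁) x₀).target) (hz₂ : z.2 ∈ (extChartAt (𝓡 n₂) y₀).target)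
    {α α' : 𝔼 n₁} (hα : J (chartParam ι x₀ y₀ z)
      (mfderiv 𝓘(ℝ, 𝔼 n₁ × 𝔼 n₂) (𝓡 m) (chartParam ι x₀ y₀) z ((α, 0) : 𝔼 n₁ × 𝔼 n₂)) =
      mfderiv 𝓘(ℝ, 𝔼 n₁ × 𝔼 n₂) (𝓡 m) (chartParam ι x₀ y₀) z ((α', 0) : 𝔼 n₁ × 𝔼 n₂))
    (γ : 𝔼 n₂) :
    fderiv ℝ (pullForm (structureForm J) (chartParam ι x₀ y₀) (0, γ) (0, γ)) z (α, 0) =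
      fderiv ℝ (pullForm (m := m) metricForm (chartParam ι x₀ y₀) (0, γ) (0, γ)) z (α', 0) := by
  have hnhds : ∀ᶠ w : 𝔼 n₁ × 𝔼 n₂ in nhds z, w.1 ∈ (extChartAt (𝓡 n₁) x₀).target ∧
      w.2 ∈ (extChartAt (𝓡 n₂) y₀).target :=
    Filter.Eventually.and
      (continuous_fst.continuousAt ((isOpen_extChartAt_target x₀).mem_nhds hz₁))
      (continuous_snd.continuousAt ((isOpen_extChartAt_target y₀).mem_nhds hz₂))
  have hb0 : ∀ β : 𝔼 n₁, pullForm (structureForm J) (chartParam ι x₀ y₀) (β, 0) (0, γ)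
      =ᶠ[nhds z] fun _ => (0 : ℝ) := fun β => by
    filter_upwards [hnhds] with w hw
    exact hι.pullForm_structureForm_inl_inr x₀ y₀ hw.1 hw.2 β γ
  have hg0 : ∀ β : 𝔼 n₁, pullForm (m := m) metricForm (chartParam ι x₀ y₀) (β, 0) (0, γ)
      =ᶠ[nhds z] fun _ => (0 : ℝ) := fun β => by
    filter_upwards [hnhds] with w hw
    exact hι.pullForm_metricForm_inl_inr x₀ y₀ hw.1 hw.2 β γ
  obtain ⟨S, hS⟩ := koszul_formula_along hcov.torsion_free
    ((contMDiffAt_chartParam hι.smooth hz₁ hz₂).of_le (m := 2) ENat.LEInfty.out)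
    ((0, γ) : 𝔼 n₁ × 𝔼 n₂) (0, γ)
  have h1 := hS _ (isParallelForm_structureForm hcov hJ hpar) (α, 0)
  have h2 := hS _ (isParallelForm_metricForm hcov) (α', 0)
  rw [(hb0 α).fderiv_eq, structureForm_apply, hα] at h1
  rw [(hg0 α').fderiv_eq] at h2
  simp only [fderiv_fun_const, Pi.zero_apply, zero_apply] at h1 h2
  linarith

/-- The derivative of the warping function in a chart vanishes. -/
theorem fderiv_warping_eq_zero (hn₂ : 0 < n₂) (hq : 0 < q) [Nonempty Mθ]
    (hJ : IsLocallyMetallic p q J) (hθ : ∀ y, 0 < θ y ∧ θ y < Real.pi / 2) (x₀ : MT) {a : 𝔼 n₁}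
    (ha : a ∈ (extChartAt (𝓡 n₁) x₀).target) :
    DifferentiableAt ℝ (f ∘ (extChartAt (𝓡 n₁) x₀).symm) a ∧
    fderiv ℝ (f ∘ (extChartAt (𝓡 n₁) x₀).symm) a = 0 := by
  obtain ⟨y₀⟩ := ‹Nonempty Mθ›
  obtain ⟨cov, hcov, hpar⟩ := hJ.parallel
  have hJ' := hJ.toIsMetallicRiemannian
  have hfd : DifferentiableAt ℝ (f ∘ (extChartAt (𝓡 n₁) x₀).symm) a :=
    (hι.warping_smooth.contMDiffAt.comp a
      (contMDiffAt_extChartAt_symm ha)).contDiffAt.differentiableAt (by simp)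
  refine ⟨hfd, ?_⟩
  -- The point `y₀` of the fibre is arbitrary, and stays fixed: the slant angle is not assumed to be
  -- differentiable.
  set c : 𝔼 n₂ := extChartAt (𝓡 n₂) y₀ y₀ with hc_def
  have hc : c ∈ (extChartAt (𝓡 n₂) y₀).target := mem_extChartAt_target y₀
  set F := chartParam (n₁ := n₁) (n₂ := n₂) ι x₀ y₀ with hF_def
  set x := (extChartAt (𝓡 n₁) x₀).symm a with hx_def
  set y := (extChartAt (𝓡 n₂) y₀).symm c with hy_def
  obtain ⟨η, t, hη0, hηt, ht⟩ := exists_eigenvector (n₁ := n₁) (n₂ := n₂) hJ' hι hn₂ x y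
  obtain ⟨γ, rfl⟩ : ∃ γ : 𝔼 n₂, _ = η := (bijective_mfderiv_extChartAt_symm hc).2 η
  set κ : ℝ := metricForm y (mfderiv 𝓘(ℝ, 𝔼 n₂) (𝓡 n₂) (extChartAt (𝓡 n₂) y₀).symm c γ)
        (mfderiv 𝓘(ℝ, 𝔼 n₂) (𝓡 n₂) (extChartAt (𝓡 n₂) y₀).symm c γ) with hκ
  set b := pullForm (structureForm J) F (0, γ) (0, γ) with hb_def
  set g := pullForm (m := m) metricForm F (0, γ) (0, γ) with hg_def
  have hFs : ContMDiffAt 𝓘(ℝ, 𝔼 n₁ × 𝔼 n₂) (𝓡 m) 2 F (a, c) :=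
    (contMDiffAt_chartParam (z := (a, c)) hι.smooth ha hc).of_le ENat.LEInfty.out
  have hbd : DifferentiableAt ℝ b (a, c) :=
    differentiableAt_pullForm (isParallelForm_structureForm hcov hJ' hpar) hFs _ _
  have hgd : DifferentiableAt ℝ g (a, c) :=
    differentiableAt_pullForm (isParallelForm_metricForm hcov) hFs _ _
  have hi : HasFDerivAt (fun a' : 𝔼 n₁ => (a', c)) (ContinuousLinearMap.inl ℝ (𝔼 n₁) (𝔼 n₂)) a :=
    hasFDerivAt_prodMk_left a c
  have hb' : HasFDerivAt (fun a' => b (a', c))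
      ((fderiv ℝ b (a, c)).comp (ContinuousLinearMap.inl ℝ (𝔼 n₁) (𝔼 n₂))) a :=
    HasFDerivAt.comp (g := b) a hbd.hasFDerivAt hi
  have hg' : HasFDerivAt (fun a' => g (a', c))
      ((fderiv ℝ g (a, c)).comp (ContinuousLinearMap.inl ℝ (𝔼 n₁) (𝔼 n₂))) a :=
    HasFDerivAt.comp (g := g) a hgd.hasFDerivAt hi
  have htgt : ∀ᶠ a' in nhds a, a' ∈ (extChartAt (𝓡 n₁) x₀).target :=
    (isOpen_extChartAt_target x₀).mem_nhds ha
  have hgval : ∀ a' ∈ (extChartAt (𝓡 n₁) x₀).target,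
      g (a', c) = f ((extChartAt (𝓡 n₁) x₀).symm a') ^ 2 * κ := fun a' ha' =>
    hι.pullForm_metricForm_inr_inr x₀ y₀ ha' hc γ
  have hbval : b (a, c) = t * g (a, c) := by
    rw [hb_def, hg_def, pullForm, pullForm,
      mfderiv_chartParam_inr (z := (a, c)) hι.smooth ha hc]
    exact hηt
  have hg0 : g (a, c) ≠ 0 := by
    rw [hg_def, pullForm, mfderiv_chartParam_inr (z := (a, c)) hι.smooth ha hc]
    exact hη0
  have hle : ∀ᶠ a' in nhds a, b (a', c) ^ 2 ≤
      Real.cos (θ y) ^ 2 * (p * b (a', c) + q * g (a', c)) * g (a', c) := by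
    filter_upwards [htgt] with a' ha'
    rw [hb_def, hg_def, pullForm, pullForm,
      mfderiv_chartParam_inr (z := (a', c)) hι.smooth ha' hc]
    exact structureForm_sq_le hJ' hι _ _ _
  have hcos : 0 < Real.cos (θ y) :=
    Real.cos_pos_of_mem_Ioo ⟨by linarith [(hθ y).1, Real.pi_pos], (hθ y).2⟩
  have hcos1 : Real.cos (θ y) < 1 := by
    rw [← Real.cos_zero]
    exact Real.cos_lt_cos_of_nonneg_of_le_pi_div_two le_rfl (hθ y).2.le (hθ y).1
  have hq' : (0 : ℝ) < q := by exact_mod_cast hq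
  have hκ0 : f x * κ ≠ 0 := by
    intro h
    apply hg0
    rw [hgval a ha, sq, mul_assoc, h, mul_zero]
  have hgder : ∀ α : 𝔼 n₁, fderiv ℝ g (a, c) (α, 0) =
      2 * (f x * κ) * fderiv ℝ (f ∘ (extChartAt (𝓡 n₁) x₀).symm) a α := by
    intro α
    have h1 : HasFDerivAt (fun a' => g (a', c)) _ a :=
      ((hfd.hasFDerivAt.pow 2).mul_const κ).congr_of_eventuallyEq
        (by filter_upwards [htgt] with a' ha' using hgval a' ha')
    have h2 := DFunLike.congr_fun (hg'.unique h1) α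
    change fderiv ℝ g (a, c) (α, 0) =
      κ * ((2 • f x ^ (2 - 1)) * fderiv ℝ (f ∘ (extChartAt (𝓡 n₁) x₀).symm) a α) at h2
    rw [h2, nsmul_eq_mul]
    push_cast
    ring
  -- The derivative `d` of the warping function satisfies `d ∘ J = t • d`, as `hrel` says.
  have hrel : ∀ α α' : 𝔼 n₁, J (F (a, c)) (mfderiv 𝓘(ℝ, 𝔼 n₁ × 𝔼 n₂) (𝓡 m) F (a, c)
      ((α, 0) : 𝔼 n₁ × 𝔼 n₂)) = mfderiv 𝓘(ℝ, 𝔼 n₁ × 𝔼 n₂) (𝓡 m) F (a, c)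
      ((α', 0) : 𝔼 n₁ × 𝔼 n₂) →
      fderiv ℝ (f ∘ (extChartAt (𝓡 n₁) x₀).symm) a α' =
        t * fderiv ℝ (f ∘ (extChartAt (𝓡 n₁) x₀).symm) a α := by
    intro α α' hα
    have h1 := hι.fderiv_structureForm_eq hJ' hcov hpar x₀ y₀ (z := (a, c)) ha hc hα γ
    have h2 := fderiv_eq_of_quadratic_extremum hb'.differentiableAt hg'.differentiableAt hq'
      (by positivity) hle hbval ht hg0 α
    rw [hb'.fderiv, hg'.fderiv] at h2
    change fderiv ℝ b (a, c) (α, 0) = t * fderiv ℝ g (a, c) (α, 0) at h2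
    change fderiv ℝ b (a, c) (α, 0) = fderiv ℝ g (a, c) (α', 0) at h1
    rw [h1, hgder, hgder] at h2
    apply mul_left_cancel₀ (mul_ne_zero two_ne_zero hκ0)
    linear_combination h2
  ext α
  obtain ⟨α', hα'⟩ := hι.exists_structure_eq x₀ y₀ (z := (a, c)) ha hc α
  have hα'' : J (F (a, c)) (mfderiv 𝓘(ℝ, 𝔼 n₁ × 𝔼 n₂) (𝓡 m) F (a, c)
      ((α', 0) : 𝔼 n₁ × 𝔼 n₂)) = mfderiv 𝓘(ℝ, 𝔼 n₁ × 𝔼 n₂) (𝓡 m) F (a, c)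
      (((p : ℝ) • α' + (q : ℝ) • α, 0) : 𝔼 n₁ × 𝔼 n₂) := by
    have : (((p : ℝ) • α' + (q : ℝ) • α, 0) : 𝔼 n₁ × 𝔼 n₂) =
        (p : ℝ) • ((α', 0) : 𝔼 n₁ × 𝔼 n₂) + (q : ℝ) • ((α, 0) : 𝔼 n₁ × 𝔼 n₂) := by simp
    rw [this]
    refine Eq.trans ?_ (((mfderiv 𝓘(ℝ, 𝔼 n₁ × 𝔼 n₂) (𝓡 m) F (a, c)).map_add _ _).trans
      (congrArg₂ (· + ·) ((mfderiv 𝓘(ℝ, 𝔼 n₁ × 𝔼 n₂) (𝓡 m) F (a, c)).map_smul _ _)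
        ((mfderiv 𝓘(ℝ, 𝔼 n₁ × 𝔼 n₂) (𝓡 m) F (a, c)).map_smul _ _))).symm
    rw [← hα']
    exact hJ'.sq _ _
  -- With `J² = pJ + q` this gives `t² = pt + q` unless `d = 0`. As also `t² = cos² θ (pt + q)` with
  -- `cos² θ < 1`, it follows that `t = 0`, and then `q = 0`.
  have e1 := hrel α α' hα'
  have e2 := hrel _ _ hα''
  rw [map_add, map_smul, map_smul, smul_eq_mul, smul_eq_mul, e1] at e2
  change fderiv ℝ (f ∘ (extChartAt (𝓡 n₁) x₀).symm) a α = 0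
  set d := fderiv ℝ (f ∘ (extChartAt (𝓡 n₁) x₀).symm) a α
  by_contra hd
  have h3 : (p : ℝ) * t + q = t ^ 2 := by
    apply mul_right_cancel₀ hd
    linear_combination e2
  rw [h3] at ht
  have h4 : t ^ 2 * (1 - Real.cos (θ y) ^ 2) = 0 := by linear_combination ht
  have h5 : 1 - Real.cos (θ y) ^ 2 ≠ 0 := by nlinarith
  have h6 : t = 0 := by simpa [h5] using h4
  rw [h6] at h3
  simp at h3
  exact hq.ne' h3

theorem isLocallyConstant_warping (hn₂ : 0 < n₂) (hq : 0 < q) [Nonempty Mθ]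
    (hJ : IsLocallyMetallic p q J) (hθ : ∀ y, 0 < θ y ∧ θ y < Real.pi / 2) :
    IsLocallyConstant f := by
  rw [IsLocallyConstant.iff_eventually_eq]
  intro x₀
  have key := fun (a : 𝔼 n₁) (ha : a ∈ (extChartAt (𝓡 n₁) x₀).target) =>
    hι.fderiv_warping_eq_zero hn₂ hq hJ hθ x₀ ha
  obtain ⟨r, hr, hball⟩ := Metric.isOpen_iff.1 (isOpen_extChartAt_target (I := 𝓡 n₁) x₀) _
    (mem_extChartAt_target x₀)
  filter_upwards [extChartAt_source_mem_nhds (I := 𝓡 n₁) x₀,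
    continuousAt_extChartAt (I := 𝓡 n₁) x₀ (Metric.ball_mem_nhds _ hr)] with x hx hx'
  have := Metric.isOpen_ball.is_const_of_fderiv_eq_zero
    (convex_ball (extChartAt (𝓡 n₁) x₀ x₀) r).isPreconnected
    (f := f ∘ (extChartAt (𝓡 n₁) x₀).symm)
    (fun a ha => (key a (hball ha)).1.differentiableWithinAt)
    (fun a ha => (key a (hball ha)).2) hx' (Metric.mem_ball_self hr)
  rwa [Function.comp_apply, Function.comp_apply, PartialEquiv.left_inv _ hx,
    extChartAt_to_inv] at this

end IsWarpedProductSemiSlant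
end Constancy

theorem mainTheorem1 {m n₁ n₂ : ℕ} (hn₁ : 0 < n₁) (hn₂ : 0 < n₂) {M MT Mθ : Type*}
    [TopologicalSpace M] [T2Space M] [SecondCountableTopology M]
    [ChartedSpace (EuclideanSpace ℝ (Fin m)) M] [IsManifold (𝓡 m) ∞ M]
    [RiemannianBundle (fun x : M => TangentSpace (𝓡 m) x)]
    [IsContMDiffRiemannianBundle (𝓡 m) ∞ (EuclideanSpace ℝ (Fin m))
      (fun x : M => TangentSpace (𝓡 m) x)]
    [TopologicalSpace MT] [T2Space MT] [SecondCountableTopology MT] [Nonempty MT]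
    [ChartedSpace (EuclideanSpace ℝ (Fin n₁)) MT] [IsManifold (𝓡 n₁) ∞ MT]
    [RiemannianBundle (fun x : MT => TangentSpace (𝓡 n₁) x)]
    [IsContMDiffRiemannianBundle (𝓡 n₁) ∞ (EuclideanSpace ℝ (Fin n₁))
      (fun x : MT => TangentSpace (𝓡 n₁) x)]
    [TopologicalSpace Mθ] [T2Space Mθ] [SecondCountableTopology Mθ] [Nonempty Mθ]
    [ChartedSpace (EuclideanSpace ℝ (Fin n₂)) Mθ] [IsManifold (𝓡 n₂) ∞ Mθ]
    [RiemannianBundle (fun x : Mθ => TangentSpace (𝓡 n₂) x)]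
    [IsContMDiffRiemannianBundle (𝓡 n₂) ∞ (EuclideanSpace ℝ (Fin n₂))
      (fun x : Mθ => TangentSpace (𝓡 n₂) x)]
    (p q : ℕ) (hp : 0 < p) (hq : 0 < q)
    (J : ∀ x : M, TangentSpace (𝓡 m) x →L[ℝ] TangentSpace (𝓡 m) x)
    (hJ : IsLocallyMetallic p q J)
    (f : MT → ℝ) (θ : Mθ → ℝ) (hθ : ∀ y, 0 < θ y ∧ θ y < Real.pi / 2)
    (ι : MT × Mθ → M) (hι : IsWarpedProductSemiSlant (n₁ := n₁) (n₂ := n₂) J f θ ι) :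
    (∀ x x' : MT, x' ∈ connectedComponent x → f x' = f x) ∧
      (ConnectedSpace MT → ∃ c : ℝ, ∀ x : MT, f x = c) := by
  have hf : IsLocallyConstant f := hι.isLocallyConstant_warping hn₂ hq hJ hθ
  refine ⟨fun x x' hx' => ?_, fun _ => ?_⟩
  · exact hf.apply_eq_of_isPreconnected isPreconnected_connectedComponent hx'
      mem_connectedComponent
  · obtain ⟨x₀⟩ := ‹Nonempty MT›
    exact ⟨f x₀, fun x => hf.apply_eq_of_isPreconnected isPreconnected_univ trivial trivial⟩
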